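/- For $s\ge 0$, positive integers $m_1,\dots,m_{s+1}$ and positive integers $\alpha_1,\dots,\alpha_s$, let $$E((m);(\alpha))=\Bigl\{(z_{(1)},\dots,z_{(s+1)})\in\mathbb{C}^{m_1}\times\dots\times\mathbb{C}^{m_{s+1}} : \|z_{(1)}\|^{2\alpha_1}+\dots+\|z_{(s)}\|^{2\alpha_s}+\|z_{(s+1)}\|^2<1\Bigr\},$$ where $\|\cdot\|$ is the Euclidean norm; such a domain is called a generalized complex pseudoellipsoid. Then for every generalized complex pseudoellipsoid $E((m);(\alpha))$ there exist a generalized complex pseudoellipsoid $E((n);(\beta))$, with blocks $n_1,\dots,n_{t+1}\ge 1$, $t\ge 1$, exponents $\beta_1,\dots,\beta_t\ge 2$ and $n_1+\dots+n_{t+1}>m_1+\dots+m_{s+1}$, and a proper holomorphic map $F:E((m);(\alpha))\to E((n);(\beta))$ such that $F$ does not extend to a continuous map from $\overline{E((m);(\alpha))}$ to $\mathbb{C}^{n_1+\dots+n_{t+1}}$. -/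

import Mathlib

/-- The space `ℂ^{m_1} × ⋯ × ℂ^{m_{s+1}}` with its Euclidean structure; the component `Z k` is the
block `z_(k+1)`, a vector of the Hermitian space `ℂ^{m_{k+1}}`. -/
abbrev BlockSpace {s : ℕ} (m : Fin (s + 1) → ℕ) : Type :=
  PiLp 2 fun k : Fin (s + 1) => EuclideanSpace ℂ (Fin (m k))

/-- The function `‖z_(1)‖^{2α_1} + ⋯ + ‖z_(s)‖^{2α_s} + ‖z_(s+1)‖²`. -/
noncomputable def pseudoNorm {s : ℕ} (m : Fin (s + 1) → ℕ) (α : Fin s → ℕ)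
    (Z : BlockSpace m) : ℝ :=
  ∑ k : Fin s, ‖Z k.castSucc‖ ^ (2 * α k) + ‖Z (Fin.last s)‖ ^ 2

/-- The generalized complex pseudoellipsoid `E((m); (α))`. -/
def pseudoellipsoid {s : ℕ} (m : Fin (s + 1) → ℕ) (α : Fin s → ℕ) : Set (BlockSpace m) :=
  {Z | pseudoNorm m α Z < 1}

/-- `F` restricts to a proper holomorphic mapping from the open set `D` to the open set `D'`. -/
def IsProperHolomorphic {V W : Type*} [NormedAddCommGroup V] [NormedSpace ℂ V]
    [NormedAddCommGroup W] [NormedSpace ℂ W] (D : Set V) (D' : Set W) (F : V → W) : Prop :=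
  DifferentiableOn ℂ F D ∧ ∃ h : Set.MapsTo F D D', IsProperMap h.restrict

/-- `F`, as a mapping on `D`, extends to a continuous mapping on the closure of `D`. -/
def ExtendsContinuouslyToClosure {V W : Type*} [TopologicalSpace V] [TopologicalSpace W]
    (D : Set V) (F : V → W) : Prop :=
  ∃ G : V → W, ContinuousOn G (closure D) ∧ Set.EqOn G F D

/-! Since `‖tensorPowers m α Z‖ ^ 2 = pseudoNorm m α Z`, the polynomial map `tensorPowers` carries
the pseudoellipsoid properly into a unit ball, so it is enough to map a ball (`exists_ball_map`).
There let a be `spiral` of one coordinate, divided by 10: its modulus is continuous on the closed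
ball, while a itself oscillates at a boundary point. Løw's theorem (`exists_norm_sq_eq_on_sphere`)
gives a holomorphic G, continuous up to the sphere, with ‖G‖² = 1 - |a|⁴ there. Thus |a|⁴ + ‖G‖² is
continuous on the closed ball, equals 1 on the sphere and, by the maximum principle for (a², G), is
less than 1 inside. Hence (a, G) is proper into ‖x‖⁴ + ‖y‖² < 1. It does not extend, because a takes
the values 1/10 and i/10 along real sequences tending to 1 (`exists_seq_spiral_eq`).

Løw's theorem is an iteration. To g one adds h = ∑ c_p · peak_p · e_p over a fine net of the sphere
(`exists_correction_of_blocks`). The unit vectors e_p are orthogonal to g(p), so ‖g + h‖² is nearly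
‖g‖² + ‖h‖². Peaks of one colour are far apart and different colours use different blocks of the
target, so the peak nearest to a point is not cancelled. The number of colours does not depend on
the scale, so one finite-dimensional target serves all steps; the deficiency φ - ‖g‖² decays
geometrically and the corrections are summable. -/

/-! ### Coloured nets of the unit sphere -/

/-- The `2 * card ι` real coordinates of a vector of `ℂ^ι`. -/
noncomputable def realCoord {ι : Type} [Fintype ι] (z : EuclideanSpace ℂ ι) (j : ι × Bool) : ℝ :=
  if j.2 then (z j.1).re else (z j.1).im

theorem abs_realCoord_sub_le {ι : Type} [Fintype ι] (z p : EuclideanSpace ℂ ι) (j : ι × Bool) :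
    |realCoord z j - realCoord p j| ≤ ‖z - p‖ := by
  have h := PiLp.norm_apply_le (z - p) j.1
  obtain ⟨i, b⟩ := j
  cases b
  · simpa [realCoord] using (Complex.abs_im_le_norm _).trans h
  · simpa [realCoord] using (Complex.abs_re_le_norm _).trans h

theorem norm_sub_le_sum_realCoord {ι : Type} [Fintype ι] (z p : EuclideanSpace ℂ ι) :
    ‖z - p‖ ≤ ∑ j, |realCoord z j - realCoord p j| := by
  classical
  have h1 : ‖z - p‖ ≤ ∑ i, ‖(z - p) i‖ := by
    have : z - p = ∑ i, EuclideanSpace.single i ((z - p) i) := by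
      ext i
      simp [Finset.sum_apply, Pi.single_apply]
    calc ‖z - p‖ = ‖∑ i, EuclideanSpace.single i ((z - p) i)‖ := by rw [← this]
      _ ≤ _ := (norm_sum_le _ _).trans (by simp)
  refine h1.trans ?_
  rw [Fintype.sum_prod_type]
  refine Finset.sum_le_sum fun i _ => ?_
  have := Complex.norm_le_abs_re_add_abs_im ((z - p) i)
  simpa [realCoord] using this

theorem exists_sum_exp_neg_abs_le {b : ℝ} (hb : 0 < b) :
    ∃ B : ℝ, 1 ≤ B ∧ ∀ (F : Finset ℤ) (k₀ : ℤ),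
      ∑ k ∈ F, Real.exp (-b * |((k : ℝ) - k₀)|) ≤ B := by
  have hs : Summable fun k : ℤ => Real.exp (-b * |(k : ℝ)|) := by
    have hn : Summable fun k : ℕ => Real.exp (-b * (k : ℝ)) := by
      have := summable_geometric_of_lt_one (r := Real.exp (-b)) (Real.exp_pos _).le
        (by simpa using hb)
      refine this.congr fun k => ?_
      rw [← Real.exp_nat_mul]
      ring_nf
    refine Summable.of_nat_of_neg ?_ ?_ <;> simpa using hn
  refine ⟨∑' k : ℤ, Real.exp (-b * |(k : ℝ)|), ?_, fun F k₀ => ?_⟩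
  · have := hs.sum_le_tsum {0} (fun _ _ => (Real.exp_pos _).le)
    simpa using this
  · classical
    have := hs.sum_le_tsum (F.image fun k => k - k₀) (fun _ _ => (Real.exp_pos _).le)
    rw [Finset.sum_image (by intro a _ c _ h; simpa using h)] at this
    simpa using this

/-- Enlarging the index set to a box turns the sum into a product of one-dimensional sums. The bound
is uniform in the centre because the lattice is translation invariant. -/
theorem exists_sum_prod_exp_neg_abs_le (J : Type) [Fintype J] {b : ℝ} (hb : 0 < b) :
    ∃ B : ℝ, 1 ≤ B ∧ ∀ (Y : Finset (J → ℤ)) (y₀ : J → ℤ),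
      ∑ y ∈ Y, ∏ j, Real.exp (-b * |((y j : ℝ) - y₀ j)|) ≤ B := by
  classical
  obtain ⟨B, hB1, hB⟩ := exists_sum_exp_neg_abs_le hb
  refine ⟨B ^ Fintype.card J, one_le_pow₀ hB1, fun Y y₀ => ?_⟩
  calc ∑ y ∈ Y, ∏ j, Real.exp (-b * |((y j : ℝ) - y₀ j)|)
      ≤ ∑ y ∈ Fintype.piFinset (fun j => Y.image fun y : J → ℤ => y j),
          ∏ j, Real.exp (-b * |((y j : ℝ) - y₀ j)|) := by
        refine Finset.sum_le_sum_of_subset_of_nonneg (fun y hy => ?_)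
          fun _ _ _ => Finset.prod_nonneg fun _ _ => (Real.exp_pos _).le
        rw [Fintype.mem_piFinset]
        exact fun j => Finset.mem_image_of_mem _ hy
    _ = ∏ j, ∑ k ∈ Y.image (fun y : J → ℤ => y j), Real.exp (-b * |((k : ℝ) - y₀ j)|) :=
        (Finset.prod_univ_sum (fun j => Y.image fun y : J → ℤ => y j)
          (fun j (k : ℤ) => Real.exp (-b * |((k : ℝ) - y₀ j)|))).symm
    _ ≤ ∏ _j : J, B := Finset.prod_le_prod
        (fun _ _ => Finset.sum_nonneg fun _ _ => (Real.exp_pos _).le) fun j _ => hB _ _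
    _ = B ^ Fintype.card J := by simp

/-- The lattice cell containing `R • z`. -/
noncomputable def latticeCell {ι : Type} [Fintype ι] (R : ℝ) (z : EuclideanSpace ℂ ι) :
    ι × Bool → ℤ := fun j => ⌊R * realCoord z j⌋

/-- Each cell coordinate moves by at most R‖z - p‖ + 1. Averaging these bounds over all coordinates
gives the weight 1 / card, and the rounding error 1 gives the factor e. -/
theorem exp_neg_mul_norm_sub_le {ι : Type} [Fintype ι] [Nonempty ι] {R : ℝ} (hR : 0 < R)
    (z p : EuclideanSpace ℂ ι) :
    Real.exp (-(R * ‖z - p‖)) ≤ Real.exp 1 * ∏ j, Real.exp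
      (-(1 / Fintype.card (ι × Bool) : ℝ) * |((latticeCell R p j : ℝ) - latticeCell R z j)|) := by
  set M : ℝ := (Fintype.card (ι × Bool) : ℝ) with hM
  have hM0 : 0 < M := by rw [hM]; exact_mod_cast Fintype.card_pos
  rw [← Real.exp_sum, ← Real.exp_add, Real.exp_le_exp]
  have h : ∀ j, |((latticeCell R p j : ℝ) - latticeCell R z j)| ≤ R * ‖z - p‖ + 1 := by
    intro j
    have h1 := mul_le_mul_of_nonneg_left (abs_realCoord_sub_le z p j) hR.le
    rw [← abs_of_pos hR, ← abs_mul, abs_of_pos hR, mul_sub, abs_le] at h1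
    have a1 := Int.floor_le (R * realCoord z j)
    have a2 := Int.lt_floor_add_one (R * realCoord z j)
    have b1 := Int.floor_le (R * realCoord p j)
    have b2 := Int.lt_floor_add_one (R * realCoord p j)
    rw [abs_le]
    unfold latticeCell
    constructor <;> linarith [h1.1, h1.2]
  have hs : ∑ j, (-(1 / M) * |((latticeCell R p j : ℝ) - latticeCell R z j)|) ≥
      ∑ _j : ι × Bool, (-(1 / M) * (R * ‖z - p‖ + 1)) :=
    Finset.sum_le_sum fun j _ => mul_le_mul_of_nonpos_left (h j) (by
      have := one_div_pos.2 hM0; linarith)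
  rw [Finset.sum_const, Finset.card_univ, nsmul_eq_mul, ← hM] at hs
  have : M * (-(1 / M) * (R * ‖z - p‖ + 1)) = -(R * ‖z - p‖ + 1) := by field_simp
  linarith

theorem mul_norm_sub_le_of_latticeCell_eq {ι : Type} [Fintype ι] {R : ℝ} (hR : 0 < R)
    {z p : EuclideanSpace ℂ ι} (h : latticeCell R p = latticeCell R z) :
    R * ‖z - p‖ ≤ Fintype.card (ι × Bool) := by
  have h1 := mul_le_mul_of_nonneg_left (norm_sub_le_sum_realCoord z p) hR.le
  refine h1.trans ?_
  rw [Finset.mul_sum]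
  calc ∑ j, R * |realCoord z j - realCoord p j| ≤ ∑ _j : ι × Bool, (1 : ℝ) := by
        refine Finset.sum_le_sum fun j _ => ?_
        have hj := congrFun h j
        unfold latticeCell at hj
        have := (Int.abs_sub_lt_one_of_floor_eq_floor hj).le
        rwa [← mul_sub, abs_mul, abs_of_pos hR, abs_sub_comm] at this
    _ = _ := by simp

theorem finite_image_latticeCell {ι : Type} [Fintype ι] (R : ℝ) (hR : 0 < R) :
    (latticeCell R '' Metric.sphere (0 : EuclideanSpace ℂ ι) 1).Finite := by
  refine (Set.Finite.pi' (t := fun _ : ι × Bool => Set.Icc ⌊-R⌋ ⌊R⌋)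
    fun _ => Set.finite_Icc _ _).subset ?_
  rintro _ ⟨z, hz, rfl⟩ j
  have := abs_realCoord_sub_le z 0 j
  have h0 : realCoord (0 : EuclideanSpace ℂ ι) j = 0 := by simp [realCoord]
  rw [h0, sub_zero, sub_zero, mem_sphere_zero_iff_norm.1 hz, abs_le] at this
  exact ⟨Int.floor_le_floor (by nlinarith), Int.floor_le_floor (by nlinarith)⟩

/-- Nets of the unit sphere at every scale `1 / R`, coloured with a fixed number of colours in such
a way that points of the same colour are far apart relative to the scale. -/
theorem exists_coloured_net (ι : Type) [Fintype ι] [Nonempty ι] :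
    ∃ A ρ : ℝ, 0 < A ∧ 0 < ρ ∧ ∀ τ : ℝ, 0 < τ → ∃ (C : Type) (_ : Fintype C),
      ∀ R : ℝ, 0 < R → ∃ (P : Finset (EuclideanSpace ℂ ι)) (colour : EuclideanSpace ℂ ι → C),
        (∀ p ∈ P, ‖p‖ = 1) ∧
        (∀ z, ‖z‖ = 1 → ∑ p ∈ P, Real.exp (-(R * ‖z - p‖)) ≤ A) ∧
        ∀ z, ‖z‖ = 1 → ∃ p ∈ P, R * ‖z - p‖ ≤ ρ ∧
          ∀ Q ⊆ P, (∀ p' ∈ Q, colour p' = colour p ∧ p' ≠ p) →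
            ∑ p' ∈ Q, Real.exp (-(R * ‖z - p'‖)) ≤ τ := by
  classical
  set M : ℝ := (Fintype.card (ι × Bool) : ℝ) with hM
  have hM0 : 0 < M := by rw [hM]; exact_mod_cast Fintype.card_pos
  obtain ⟨B, hB1, hB⟩ := exists_sum_prod_exp_neg_abs_le (ι × Bool) (b := 1 / (2 * M))
    (by positivity)
  have hB0 : 0 < B := by linarith
  refine ⟨Real.exp 1 * B, M, by positivity, hM0, fun τ hτ => ?_⟩
  -- q + 1 is the period of the colouring in each coordinate: the tail beyond that lattice distance
  -- is at most τ.
  obtain ⟨q, hq⟩ : ∃ q : ℕ, Real.exp 1 * B * Real.exp (-(1 / (2 * M)) * (q + 1 : ℕ)) ≤ τ := by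
    have ht : Filter.Tendsto (fun q : ℕ => Real.exp 1 * B * Real.exp (-(1 / (2 * M)) * (q + 1 : ℕ)))
        Filter.atTop (nhds (Real.exp 1 * B * 0)) := by
      refine Filter.Tendsto.const_mul _ (Real.tendsto_exp_atBot.comp ?_)
      refine Filter.Tendsto.const_mul_atTop_of_neg (by
        have : 0 < 1 / (2 * M) := by positivity
        linarith) ?_
      exact tendsto_natCast_atTop_atTop.comp (Filter.tendsto_add_atTop_nat 1)
    rw [mul_zero] at ht
    exact (ht.eventually_le_const hτ).exists
  refine ⟨ι × Bool → ZMod (q + 1), inferInstance, fun R hR => ?_⟩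
  -- One point of the sphere is kept from each lattice cell that meets it.
  obtain ⟨P', hP'S, hbij⟩ := Set.exists_subset_bijOn
    (Metric.sphere (0 : EuclideanSpace ℂ ι) 1) (latticeCell R)
  have hfin : P'.Finite := by
    have := finite_image_latticeCell (ι := ι) R hR
    rw [← hbij.image_eq] at this
    exact this.of_finite_image hbij.injOn
  lift P' to Finset (EuclideanSpace ℂ ι) using hfin with P
  have key : ∀ z, ∀ Q ⊆ P, ∑ p ∈ Q, ∏ j, Real.exp
      (-(1 / (2 * M)) * |((latticeCell R p j : ℝ) - latticeCell R z j)|) ≤ B := by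
    intro z Q hQ
    have := hB (Q.image (latticeCell R)) (latticeCell R z)
    rwa [Finset.sum_image (hbij.injOn.mono (by exact_mod_cast hQ))] at this
  -- The colour is the cell index modulo q + 1, so distinct net points of equal colour differ by at
  -- least q + 1 in some cell coordinate.
  refine ⟨P, fun z j => (latticeCell R z j : ZMod (q + 1)), fun p hp => by
    simpa using hP'S hp, fun z _ => ?_, fun z hz => ?_⟩
  · refine le_trans ?_ (mul_le_mul_of_nonneg_left (key z P subset_rfl) (Real.exp_pos 1).le)
    rw [Finset.mul_sum]
    refine Finset.sum_le_sum fun p _ => (exp_neg_mul_norm_sub_le hR z p).trans ?_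
    refine mul_le_mul_of_nonneg_left (Finset.prod_le_prod (fun _ _ => (Real.exp_pos _).le)
      fun j _ => Real.exp_le_exp.2 ?_) (Real.exp_pos 1).le
    rw [← hM]
    refine mul_le_mul_of_nonneg_right ?_ (abs_nonneg _)
    rw [neg_le_neg_iff]
    exact one_div_le_one_div_of_le hM0 (by linarith)
  · obtain ⟨p, hpP, hpz⟩ := hbij.surjOn (Set.mem_image_of_mem (latticeCell R)
      (show z ∈ Metric.sphere 0 1 by simpa using hz))
    refine ⟨p, hpP, mul_norm_sub_le_of_latticeCell_eq hR hpz, fun Q hQP hQ => ?_⟩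
    refine le_trans ?_ hq
    rw [mul_right_comm]
    refine le_trans ?_ (mul_le_mul_of_nonneg_left (key z Q hQP) (by positivity))
    rw [Finset.mul_sum]
    refine Finset.sum_le_sum fun p' hp' => (exp_neg_mul_norm_sub_le hR z p').trans ?_
    rw [mul_assoc]
    refine mul_le_mul_of_nonneg_left ?_ (Real.exp_pos 1).le
    rw [← hM, ← Real.exp_sum, ← Real.exp_sum, ← Real.exp_add, Real.exp_le_exp,
      ← Finset.mul_sum, ← Finset.mul_sum]
    obtain ⟨hcol, hne⟩ := hQ p' hp'
    have hcell : latticeCell R p' ≠ latticeCell R p := fun h =>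
      hne (hbij.injOn (hQP hp') hpP h)
    obtain ⟨j, hj⟩ := Function.ne_iff.1 hcell
    have hdvd : ((q + 1 : ℕ) : ℤ) ∣ latticeCell R p' j - latticeCell R p j := by
      rw [← ZMod.intCast_zmod_eq_zero_iff_dvd, Int.cast_sub, sub_eq_zero]
      exact congrFun hcol j
    have hle := Int.le_of_dvd (abs_pos.2 (sub_ne_zero.2 hj)) ((dvd_abs _ _).2 hdvd)
    rw [hpz] at hle
    have hle' : ((q + 1 : ℕ) : ℝ) ≤ |((latticeCell R p' j : ℝ) - latticeCell R z j)| := by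
      exact_mod_cast hle
    have hsum := Finset.single_le_sum
      (f := fun j => |((latticeCell R p' j : ℝ) - latticeCell R z j)|)
      (fun _ _ => abs_nonneg _) (Finset.mem_univ j)
    -- Half of the decay pays for the separation q + 1; the other half keeps the lattice sum bounded
    -- by B.
    have h12 : 1 / M = 1 / (2 * M) + 1 / (2 * M) := by field_simp; norm_num
    have hpos : 0 < 1 / (2 * M) := by positivity
    have := mul_le_mul_of_nonneg_left (hle'.trans hsum) hpos.le
    rw [h12]
    linarith

/-! ### One correction step -/

/-- Uniform continuity handles short distances, and the slope diam / δ handles the others. This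
stands in for a Lipschitz bound when f is merely continuous. -/
theorem ContinuousOn.exists_dist_le_add_mul {X Y : Type*} [PseudoMetricSpace X]
    [PseudoMetricSpace Y] {f : X → Y} {K : Set X} (hK : IsCompact K) (hf : ContinuousOn f K)
    {ε : ℝ} (hε : 0 < ε) :
    ∃ L : ℝ, ∀ x ∈ K, ∀ y ∈ K, dist (f x) (f y) ≤ ε + L * dist x y := by
  obtain ⟨δ, hδ, h⟩ := Metric.uniformContinuousOn_iff.1
    (hK.uniformContinuousOn_of_continuous hf) ε hε
  have hb := (hK.image_of_continuousOn hf).isBounded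
  refine ⟨Metric.diam (f '' K) / δ, fun x hx y hy => ?_⟩
  have hD : 0 ≤ Metric.diam (f '' K) := Metric.diam_nonneg
  rcases lt_or_ge (dist x y) δ with hlt | hge
  · have h1 := h x hx y hy hlt
    have : 0 ≤ Metric.diam (f '' K) / δ * dist x y := by positivity
    linarith
  · have h1 := Metric.dist_le_diam_of_mem hb (Set.mem_image_of_mem f hx) (Set.mem_image_of_mem f hy)
    have h2 : Metric.diam (f '' K) ≤ Metric.diam (f '' K) / δ * dist x y := by
      rw [div_mul_eq_mul_div, le_div_iff₀ hδ]
      exact mul_le_mul_of_nonneg_left hge hD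
    linarith

theorem exists_norm_eq_one_inner_eq_zero (a : EuclideanSpace ℂ (Fin 2)) :
    ∃ e : EuclideanSpace ℂ (Fin 2), ‖e‖ = 1 ∧ inner ℂ a e = 0 := by
  obtain ⟨b, hb, hab⟩ : ∃ b : EuclideanSpace ℂ (Fin 2), b ≠ 0 ∧ inner ℂ a b = 0 := by
    by_cases ha : a = 0
    · exact ⟨EuclideanSpace.single 0 1, by simp, by simp [ha]⟩
    · refine ⟨!₂[-(starRingEnd ℂ (a 1)), starRingEnd ℂ (a 0)], fun h => ha ?_, ?_⟩
      · have h0 := congrFun (congrArg WithLp.ofLp h) 0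
        have h1 := congrFun (congrArg WithLp.ofLp h) 1
        ext i
        fin_cases i <;> simp_all
      · simp [PiLp.inner_apply, Fin.sum_univ_two, mul_comm]
  refine ⟨((‖b‖⁻¹ : ℝ) : ℂ) • b, ?_, ?_⟩
  · rw [norm_smul, Complex.norm_real, norm_inv, norm_norm, inv_mul_cancel₀ (norm_ne_zero_iff.2 hb)]
  · rw [inner_smul_right, hab, mul_zero]

/-- The space `(ℂ²)^C`. -/
abbrev PairSpace (C : Type) : Type := PiLp 2 fun _ : C => EuclideanSpace ℂ (Fin 2)

theorem exists_block_unit_inner_eq_zero {C : Type} [Fintype C] [DecidableEq C] (c : C)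
    (a : PairSpace C) :
    ∃ e : PairSpace C, ‖e‖ = 1 ∧ ‖e c‖ = 1 ∧ (∀ c', c' ≠ c → e c' = 0) ∧ inner ℂ a e = 0 := by
  obtain ⟨e, he, hae⟩ := exists_norm_eq_one_inner_eq_zero (a c)
  refine ⟨PiLp.single 2 c e, ?_, ?_, fun c' hc' => ?_, ?_⟩
  · rw [PiLp.norm_single, he]
  · simpa using he
  · simp [hc']
  · rw [PiLp.inner_apply, Finset.sum_eq_single c]
    · simpa using hae
    · intro c' _ hc'
      simp [hc']
    · simp

/-- The peak function `z ↦ exp (R² (⟪p, z⟫ - 1))` at the point `p` of the unit sphere. -/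
noncomputable def peak {V : Type*} [NormedAddCommGroup V] [InnerProductSpace ℂ V] (R : ℝ) (p z : V) :
    ℂ := Complex.exp ((R : ℂ) ^ 2 * (inner ℂ p z - 1))

theorem differentiable_peak {V : Type*} [NormedAddCommGroup V] [InnerProductSpace ℂ V] (R : ℝ)
    (p : V) : Differentiable ℂ (peak R p) := by
  have : Differentiable ℂ fun z : V => inner ℂ p z := (innerSL ℂ p).differentiable
  unfold peak
  fun_prop

theorem norm_peak {V : Type*} [NormedAddCommGroup V] [InnerProductSpace ℂ V] (R : ℝ) {p z : V}
    (hp : ‖p‖ = 1) (hz : ‖z‖ = 1) : ‖peak R p z‖ = Real.exp (-((R * ‖z - p‖) ^ 2 / 2)) := by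
  rw [peak, Complex.norm_exp]
  congr 1
  have h := norm_sub_sq (𝕜 := ℂ) z p
  have hre : (inner ℂ p z).re = RCLike.re (inner ℂ z p) := by
    exact inner_re_symm (𝕜 := ℂ) p z
  have : ((R : ℂ) ^ 2 * (inner ℂ p z - 1)).re = R ^ 2 * ((inner ℂ p z).re - 1) := by
    rw [← Complex.ofReal_pow, Complex.re_ofReal_mul]; simp
  rw [this, hre, mul_pow, h, hp, hz]
  ring

/-- Completing the square: the Gaussian peak absorbs the exponential losses incurred in comparing
data at z and at p, and still leaves the factor summable over the net. -/
theorem exp_mul_exp_neg_sq_le (a u : ℝ) :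
    Real.exp (a * u) * Real.exp (-(u ^ 2 / 2)) ≤ Real.exp ((a + 1) ^ 2 / 2) * Real.exp (-u) := by
  rw [← Real.exp_add, ← Real.exp_add, Real.exp_le_exp]
  nlinarith [sq_nonneg (u - (a + 1))]

theorem norm_add_sq_complex {W : Type*} [NormedAddCommGroup W] [InnerProductSpace ℂ W] (x y : W) :
    ‖x + y‖ ^ 2 = ‖x‖ ^ 2 + 2 * (inner ℂ x y).re + ‖y‖ ^ 2 := by
  simpa using norm_add_sq (𝕜 := ℂ) x y

set_option maxHeartbeats 1600000 in
/-- One step of Løw's correction scheme: a holomorphic map `g` with `‖g‖² < φ` on the unit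
sphere can be corrected by a map of size at most the square root of the deficiency `φ - ‖g‖²`, so
that the deficiency stays positive and shrinks by a fixed factor. The target `W` is assumed to have blocks
indexed by enough colours. -/
theorem exists_correction_of_blocks (ι : Type) [Fintype ι] [Nonempty ι] :
    ∃ (C : Type) (_ : Fintype C) (κ : ℝ), 0 < κ ∧ κ < 1 ∧
      ∀ (W : Type) [NormedAddCommGroup W] [InnerProductSpace ℂ W]
        (W' : Type) [NormedAddCommGroup W'] [NormedSpace ℂ W'] (π : C → W →ₗ[ℂ] W'),
        (∀ c x, ‖π c x‖ ≤ ‖x‖) →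
        (∀ c a, ∃ e : W, ‖e‖ = 1 ∧ ‖π c e‖ = 1 ∧ (∀ c', c' ≠ c → π c' e = 0) ∧ inner ℂ a e = 0) →
      ∀ (g : EuclideanSpace ℂ ι → W) (φ : EuclideanSpace ℂ ι → ℝ),
        Differentiable ℂ g → ContinuousOn φ (Metric.sphere 0 1) →
        (∀ z, ‖z‖ = 1 → ‖g z‖ ^ 2 < φ z) →
        ∃ h : EuclideanSpace ℂ ι → W, Differentiable ℂ h ∧ ∀ z, ‖z‖ = 1 →
          ‖h z‖ ^ 2 ≤ φ z - ‖g z‖ ^ 2 ∧ ‖g z + h z‖ ^ 2 < φ z ∧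
          φ z - ‖g z + h z‖ ^ 2 ≤ (1 - κ) * (φ z - ‖g z‖ ^ 2) := by
  classical
  obtain ⟨A, ρ, hA, hρ, hnet⟩ := exists_coloured_net ι
  -- A peak is at least a within distance ρ / R of its centre. The tolerance a / (8e²) makes the
  -- same-coloured tail at most half of the main term, and σ below makes ‖h‖ ≤ s / 2.
  set a : ℝ := Real.exp (-(ρ ^ 2 / 2)) with ha
  have ha0 : 0 < a := Real.exp_pos _
  obtain ⟨C, _, hnet⟩ := hnet (a / (8 * Real.exp 2)) (by positivity)
  set σ : ℝ := 1 / (4 * Real.exp 2 * A) with hσ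
  have hσ0 : 0 < σ := by positivity
  set κ₀ : ℝ := (σ * a / 4) ^ 2 with hκ₀
  have hκ0 : 0 < κ₀ := by positivity
  refine ⟨C, inferInstance, min (κ₀ / 2) (1 / 2), by positivity, by
    exact (min_le_right _ _).trans_lt (by norm_num), fun W _ _ W' _ _ π hπ hblocks g φ hg hφ hgφ => ?_⟩
  set S : Set (EuclideanSpace ℂ ι) := Metric.sphere 0 1 with hS
  have hScomp : IsCompact S := isCompact_sphere 0 1
  have hSne : S.Nonempty := NormedSpace.sphere_nonempty.2 zero_le_one
  have hmem : ∀ z, z ∈ S ↔ ‖z‖ = 1 := fun z => mem_sphere_zero_iff_norm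
  set s : EuclideanSpace ℂ ι → ℝ := fun z => Real.sqrt (φ z - ‖g z‖ ^ 2) with hs
  have hs0 : ∀ z, ‖z‖ = 1 → 0 < s z := fun z hz => Real.sqrt_pos.2 (sub_pos.2 (hgφ z hz))
  have hss : ∀ z, ‖z‖ = 1 → s z ^ 2 = φ z - ‖g z‖ ^ 2 := fun z hz =>
    Real.sq_sqrt (sub_pos.2 (hgφ z hz)).le
  have hscont : ContinuousOn s S :=
    (hφ.sub (hg.continuous.norm.pow 2).continuousOn).sqrt
  obtain ⟨δ, hδ, hδs⟩ : ∃ δ, 0 < δ ∧ ∀ z, ‖z‖ = 1 → δ ≤ s z := by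
    obtain ⟨z₀, hz₀, hmin⟩ := hScomp.exists_isMinOn hSne hscont
    exact ⟨s z₀, hs0 z₀ ((hmem _).1 hz₀), fun z hz => hmin ((hmem z).2 hz)⟩
  -- Chosen so that s p ≥ s z / 2 when R‖z - p‖ ≤ ρ; ε₂ below makes the cross term at most κ₀ s² /
  -- 4.
  set ε₁ : ℝ := 1 / (2 * (1 + ρ)) with hε₁
  have hε₁0 : 0 < ε₁ := by positivity
  have hε₁1 : ε₁ ≤ 1 := by
    rw [hε₁, div_le_one (by positivity)]; linarith
  set ε₂ : ℝ := κ₀ * δ / (4 * Real.exp (9 / 2)) with hε₂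
  have hε₂0 : 0 < ε₂ := by positivity
  obtain ⟨L₁, hL₁⟩ := hscont.exists_dist_le_add_mul hScomp (mul_pos hε₁0 hδ)
  obtain ⟨L₂, hL₂⟩ := hg.continuous.continuousOn.exists_dist_le_add_mul hScomp hε₂0
  set R : ℝ := max 1 (max (L₁ / (ε₁ * δ)) (L₂ / ε₂)) with hR
  have hR0 : 0 < R := lt_of_lt_of_le one_pos (le_max_left _ _)
  have hRL₁ : L₁ ≤ ε₁ * δ * R := by
    have : L₁ / (ε₁ * δ) ≤ R := (le_max_left _ _).trans (le_max_right _ _)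
    rwa [div_le_iff₀ (by positivity), mul_comm] at this
  have hRL₂ : L₂ ≤ ε₂ * R := by
    have : L₂ / ε₂ ≤ R := (le_max_right _ _).trans (le_max_right _ _)
    rwa [div_le_iff₀ hε₂0, mul_comm] at this
  have hsdist : ∀ z p, ‖z‖ = 1 → ‖p‖ = 1 → |s z - s p| ≤ ε₁ * s z * (1 + R * ‖z - p‖) := by
    intro z p hz hp
    have h1 := hL₁ z ((hmem z).2 hz) p ((hmem p).2 hp)
    rw [Real.dist_eq, dist_eq_norm] at h1
    have h2 := mul_le_mul_of_nonneg_right hRL₁ (norm_nonneg (z - p))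
    have h3 : ε₁ * δ * (1 + R * ‖z - p‖) ≤ ε₁ * s z * (1 + R * ‖z - p‖) := by
      have := hδs z hz
      gcongr
    linarith
  have hsup : ∀ z p, ‖z‖ = 1 → ‖p‖ = 1 → s p ≤ 2 * s z * Real.exp (R * ‖z - p‖) := by
    intro z p hz hp
    have h1 := (abs_le.1 (hsdist z p hz hp)).1
    have h2 := Real.add_one_le_exp (R * ‖z - p‖)
    have h3 : 0 ≤ R * ‖z - p‖ := by positivity
    have h4 := hs0 z hz
    have h5 : ε₁ * s z * (1 + R * ‖z - p‖) ≤ 1 * s z * (1 + R * ‖z - p‖) := by gcongr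
    have h6 : s z * (1 + R * ‖z - p‖) ≤ s z * Real.exp (R * ‖z - p‖) := by
      gcongr; linarith
    have h7 : s z * 1 ≤ s z * (1 + R * ‖z - p‖) := by gcongr; linarith
    linarith
  have hgdist : ∀ z p, ‖z‖ = 1 → ‖p‖ = 1 → ‖g z - g p‖ ≤ ε₂ * Real.exp (R * ‖z - p‖) := by
    intro z p hz hp
    have h1 := hL₂ z ((hmem z).2 hz) p ((hmem p).2 hp)
    rw [dist_eq_norm, dist_eq_norm] at h1
    have h2 := mul_le_mul_of_nonneg_right hRL₂ (norm_nonneg (z - p))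
    have h3 := mul_le_mul_of_nonneg_left (Real.add_one_le_exp (R * ‖z - p‖)) hε₂0.le
    linarith
  obtain ⟨P, colour, hP1, hPA, hPnear⟩ := hnet R hR0
  choose e he1 hec he0 heg using fun p => hblocks (colour p) (g p)
  set k : EuclideanSpace ℂ ι → EuclideanSpace ℂ ι → ℝ := fun p z => σ * s p * ‖peak R p z‖ with hk
  set h : EuclideanSpace ℂ ι → W :=
    fun z => ∑ p ∈ P, (peak R p z * ((σ * s p : ℝ) : ℂ)) • e p with hh
  have hcoef : ∀ p z, ‖p‖ = 1 → ‖peak R p z * ((σ * s p : ℝ) : ℂ)‖ = k p z := by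
    intro p z hp
    rw [norm_mul, Complex.norm_real, Real.norm_of_nonneg (mul_pos hσ0 (hs0 p hp)).le, mul_comm]
  have hkle : ∀ z p, ‖z‖ = 1 → ‖p‖ = 1 →
      k p z ≤ σ * (2 * s z) * Real.exp 2 * Real.exp (-(R * ‖z - p‖)) := by
    intro z p hz hp
    have h1 := exp_mul_exp_neg_sq_le 1 (R * ‖z - p‖)
    rw [one_mul, show ((1 : ℝ) + 1) ^ 2 / 2 = 2 by norm_num] at h1
    have h2 := hsup z p hz hp
    have h3 := hs0 z hz
    calc k p z = σ * s p * Real.exp (-((R * ‖z - p‖) ^ 2 / 2)) := by rw [hk, ← norm_peak R hp hz]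
      _ ≤ σ * (2 * s z * Real.exp (R * ‖z - p‖)) * Real.exp (-((R * ‖z - p‖) ^ 2 / 2)) := by gcongr
      _ = σ * (2 * s z) * (Real.exp (R * ‖z - p‖) * Real.exp (-((R * ‖z - p‖) ^ 2 / 2))) := by ring
      _ ≤ σ * (2 * s z) * (Real.exp 2 * Real.exp (-(R * ‖z - p‖))) := by gcongr
      _ = _ := by ring
  have hhle : ∀ z, ‖z‖ = 1 → ‖h z‖ ≤ s z / 2 := by
    intro z hz
    have h3 := hs0 z hz
    calc ‖h z‖ ≤ ∑ p ∈ P, ‖(peak R p z * ((σ * s p : ℝ) : ℂ)) • e p‖ := norm_sum_le _ _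
      _ ≤ ∑ p ∈ P, σ * (2 * s z) * Real.exp 2 * Real.exp (-(R * ‖z - p‖)) := by
          refine Finset.sum_le_sum fun p hp => ?_
          rw [norm_smul, he1, mul_one, hcoef p z (hP1 p hp)]
          exact hkle z p hz (hP1 p hp)
      _ ≤ σ * (2 * s z) * Real.exp 2 * A := by
          rw [← Finset.mul_sum]
          exact mul_le_mul_of_nonneg_left (hPA z hz) (by positivity)
      _ = s z / 2 := by rw [hσ]; field_simp; norm_num
  have hcross : ∀ z, ‖z‖ = 1 → ‖inner ℂ (g z) (h z)‖ ≤ κ₀ / 4 * s z ^ 2 := by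
    intro z hz
    have h3 := hs0 z hz
    have hterm : ∀ p ∈ P, ‖inner ℂ (g z) ((peak R p z * ((σ * s p : ℝ) : ℂ)) • e p)‖ ≤
        σ * (2 * s z) * ε₂ * Real.exp (9 / 2) * Real.exp (-(R * ‖z - p‖)) := by
      intro p hp
      have hp1 := hP1 p hp
      have h1 := exp_mul_exp_neg_sq_le 2 (R * ‖z - p‖)
      rw [show ((2 : ℝ) + 1) ^ 2 / 2 = 9 / 2 by norm_num,
        show 2 * (R * ‖z - p‖) = R * ‖z - p‖ + R * ‖z - p‖ by ring, Real.exp_add] at h1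
      have h2 : ‖inner ℂ (g z) (e p)‖ ≤ ε₂ * Real.exp (R * ‖z - p‖) := by
        -- Orthogonality of e p to g p leaves only the oscillation of g between z and p.
        have : inner ℂ (g z) (e p) = inner ℂ (g z - g p) (e p) := by
          rw [inner_sub_left, heg, sub_zero]
        rw [this]
        refine (norm_inner_le_norm _ _).trans ?_
        rw [he1, mul_one]
        exact hgdist z p hz hp1
      have h4 := hsup z p hz hp1
      rw [inner_smul_right, norm_mul, hcoef p z hp1]
      calc k p z * ‖inner ℂ (g z) (e p)‖
          ≤ (σ * (2 * s z * Real.exp (R * ‖z - p‖)) * Real.exp (-((R * ‖z - p‖) ^ 2 / 2))) *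
            (ε₂ * Real.exp (R * ‖z - p‖)) := by
              rw [← norm_peak R hp1 hz]; simp only [hk]; gcongr
        _ = σ * (2 * s z) * ε₂ * (Real.exp (R * ‖z - p‖) * Real.exp (R * ‖z - p‖) *
            Real.exp (-((R * ‖z - p‖) ^ 2 / 2))) := by ring
        _ ≤ σ * (2 * s z) * ε₂ * (Real.exp (9 / 2) * Real.exp (-(R * ‖z - p‖))) := by gcongr
        _ = _ := by ring
    rw [hh, inner_sum]
    calc _ ≤ ∑ p ∈ P, σ * (2 * s z) * ε₂ * Real.exp (9 / 2) * Real.exp (-(R * ‖z - p‖)) :=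
          (norm_sum_le _ _).trans (Finset.sum_le_sum hterm)
      _ ≤ σ * (2 * s z) * ε₂ * Real.exp (9 / 2) * A := by
          rw [← Finset.mul_sum]
          exact mul_le_mul_of_nonneg_left (hPA z hz) (by positivity)
      _ = κ₀ * δ * s z / (8 * Real.exp 2) := by rw [hσ, hε₂]; field_simp; norm_num
      _ ≤ κ₀ * δ * s z / 4 := by
          have : (1 : ℝ) ≤ Real.exp 2 := Real.one_le_exp (by norm_num)
          gcongr
          linarith
      _ ≤ κ₀ * s z * s z / 4 := by
          have := hδs z hz
          gcongr
      _ = _ := by ring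
  have hlow : ∀ z, ‖z‖ = 1 → κ₀ * s z ^ 2 ≤ ‖h z‖ ^ 2 := by
    intro z hz
    have h3 := hs0 z hz
    obtain ⟨p, hpP, hpz, hfar⟩ := hPnear z hz
    have hp1 := hP1 p hpP
    have hblock : π (colour p) (h z) = (peak R p z * ((σ * s p : ℝ) : ℂ)) • π (colour p) (e p) +
        ∑ p' ∈ P.filter (fun p' => colour p' = colour p ∧ p' ≠ p),
          (peak R p' z * ((σ * s p' : ℝ) : ℂ)) • π (colour p) (e p') := by
      have h0 : π (colour p) (h z) =
          ∑ p' ∈ P, (peak R p' z * ((σ * s p' : ℝ) : ℂ)) • π (colour p) (e p') := by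
        simp only [hh, map_sum, map_smul]
      rw [h0, ← Finset.add_sum_erase _ _ hpP]
      congr 1
      symm
      refine Finset.sum_subset (fun x hx => ?_) fun x hx hx' => ?_
      · rw [Finset.mem_filter] at hx
        exact Finset.mem_erase.2 ⟨hx.2.2, hx.1⟩
      · rw [Finset.mem_erase] at hx
        rw [he0 x (colour p), smul_zero]
        intro hc
        exact hx' (Finset.mem_filter.2 ⟨hx.2, hc.symm, hx.1⟩)
    have htail : ‖∑ p' ∈ P.filter (fun p' => colour p' = colour p ∧ p' ≠ p),
          (peak R p' z * ((σ * s p' : ℝ) : ℂ)) • π (colour p) (e p')‖ ≤ σ * s z * a / 4 := by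
      calc _ ≤ ∑ p' ∈ P.filter (fun p' => colour p' = colour p ∧ p' ≠ p),
            σ * (2 * s z) * Real.exp 2 * Real.exp (-(R * ‖z - p'‖)) := by
            refine (norm_sum_le _ _).trans (Finset.sum_le_sum fun p' hp' => ?_)
            rw [Finset.mem_filter] at hp'
            have hp1' := hP1 p' hp'.1
            rw [norm_smul, ← hp'.2.1, hec, mul_one, hcoef p' z hp1']
            exact hkle z p' hz hp1'
        _ ≤ σ * (2 * s z) * Real.exp 2 * (a / (8 * Real.exp 2)) := by
            rw [← Finset.mul_sum]
            refine mul_le_mul_of_nonneg_left (hfar _ (Finset.filter_subset _ _) fun p' hp' => ?_)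
              (by positivity)
            exact (Finset.mem_filter.1 hp').2
        _ = _ := by field_simp; norm_num
    have hmain : σ * s z * a / 2 ≤ ‖(peak R p z * ((σ * s p : ℝ) : ℂ)) • π (colour p) (e p)‖ := by
      rw [norm_smul, hec, mul_one, hcoef p z hp1, hk]
      have h4 : s z / 2 ≤ s p := by
        have h5 := (abs_le.1 (hsdist z p hz hp1)).2
        have h6 : ε₁ * s z * (1 + R * ‖z - p‖) ≤ ε₁ * s z * (1 + ρ) := by gcongr
        have h7 : ε₁ * s z * (1 + ρ) = s z / 2 := by rw [hε₁]; field_simp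
        linarith
      have h5 : a ≤ ‖peak R p z‖ := by
        rw [norm_peak R hp1 hz, ha, Real.exp_le_exp]
        have : (R * ‖z - p‖) ^ 2 ≤ ρ ^ 2 := by gcongr
        linarith
      calc σ * s z * a / 2 = σ * (s z / 2) * a := by ring
        _ ≤ σ * s p * ‖peak R p z‖ := by gcongr
    have hn : σ * s z * a / 4 ≤ ‖h z‖ := by
      refine le_trans ?_ (hπ (colour p) (h z))
      rw [hblock]
      have := norm_sub_le_norm_add ((peak R p z * ((σ * s p : ℝ) : ℂ)) • π (colour p) (e p))
        (∑ p' ∈ P.filter (fun p' => colour p' = colour p ∧ p' ≠ p),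
          (peak R p' z * ((σ * s p' : ℝ) : ℂ)) • π (colour p) (e p'))
      linarith
    calc κ₀ * s z ^ 2 = (σ * s z * a / 4) ^ 2 := by rw [hκ₀]; ring
      _ ≤ _ := by gcongr
  refine ⟨h, ?_, fun z hz => ?_⟩
  · rw [hh]
    refine Differentiable.fun_sum fun p _ => ?_
    exact ((differentiable_peak R p).mul_const _).smul_const _
  · have h1 := hhle z hz
    have h2 := abs_le.1 ((Complex.abs_re_le_norm _).trans (hcross z hz))
    have h3 := hlow z hz
    -- With `h3` this also forces κ₀ s² ≤ s² / 4, which keeps the deficiency positive despite the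
    -- cross term. The latter consumes at most half of the gain κ₀ s².
    have h4 : ‖h z‖ ^ 2 ≤ (s z / 2) ^ 2 := by gcongr
    have h5 := hss z hz
    have h6 : 0 < s z ^ 2 := by have := hs0 z hz; positivity
    have h7 : min (κ₀ / 2) (1 / 2) * s z ^ 2 ≤ κ₀ / 2 * s z ^ 2 := by
      gcongr; exact min_le_left _ _
    rw [norm_add_sq_complex, ← h5]
    refine ⟨by linarith, by linarith, by linarith⟩

/-- Løw's correction step for maps to `(ℂ²)^C`: a holomorphic map `g` with `‖g‖² < φ` on the unit
sphere can be corrected by a map of size at most the square root of the deficiency `φ - ‖g‖²`, so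
that the deficiency stays positive and shrinks by a fixed factor. -/
theorem exists_correction (ι : Type) [Fintype ι] [Nonempty ι] :
    ∃ (C : Type) (_ : Fintype C) (κ : ℝ), 0 < κ ∧ κ < 1 ∧
      ∀ (g : EuclideanSpace ℂ ι → PairSpace C) (φ : EuclideanSpace ℂ ι → ℝ),
        Differentiable ℂ g → ContinuousOn φ (Metric.sphere 0 1) →
        (∀ z, ‖z‖ = 1 → ‖g z‖ ^ 2 < φ z) →
        ∃ h : EuclideanSpace ℂ ι → PairSpace C, Differentiable ℂ h ∧ ∀ z, ‖z‖ = 1 →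
          ‖h z‖ ^ 2 ≤ φ z - ‖g z‖ ^ 2 ∧ ‖g z + h z‖ ^ 2 < φ z ∧
          φ z - ‖g z + h z‖ ^ 2 ≤ (1 - κ) * (φ z - ‖g z‖ ^ 2) := by
  classical
  obtain ⟨C, _, κ, h0, h1, h⟩ := exists_correction_of_blocks ι
  refine ⟨C, inferInstance, κ, h0, h1, h (PairSpace C) (EuclideanSpace ℂ (Fin 2))
    (fun c => (PiLp.proj 2 (fun _ : C => EuclideanSpace ℂ (Fin 2)) c).toLinearMap)
    (fun c x => ?_) fun c a => ?_⟩
  · exact PiLp.norm_apply_le x c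
  · exact exists_block_unit_inner_eq_zero c a

/-! ### Iteration and Løw's theorem -/

/-- The one-variable Cauchy estimate on the complex line through z in direction v, with a disc of
radius (1 - r) / ‖v‖. -/
theorem norm_fderiv_le_of_norm_le {V W : Type*} [NormedAddCommGroup V] [NormedSpace ℂ V]
    [NormedAddCommGroup W] [NormedSpace ℂ W] {f : V → W} (hf : Differentiable ℂ f) {M r : ℝ}
    (hr : r < 1) (hM : 0 ≤ M) (h : ∀ z, ‖z‖ ≤ 1 → ‖f z‖ ≤ M) {z : V} (hz : ‖z‖ ≤ r) :
    ‖fderiv ℂ f z‖ ≤ M / (1 - r) := by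
  have hr' : 0 < 1 - r := sub_pos.2 hr
  refine ContinuousLinearMap.opNorm_le_bound _ (by positivity) fun v => ?_
  rcases eq_or_ne v 0 with rfl | hv
  · simp
  have hv' : 0 < ‖v‖ := norm_pos_iff.2 hv
  have hline : ∀ t : ℂ, HasDerivAt (fun t : ℂ => z + t • v) v t := fun t => by
    simpa using ((hasDerivAt_id t).smul_const v).const_add z
  have hdiff : Differentiable ℂ fun t : ℂ => f (z + t • v) := fun t =>
    (hf _).comp t (hline t).differentiableAt
  have hderiv : deriv (fun t : ℂ => f (z + t • v)) 0 = fderiv ℂ f z v := by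
    have h1 : HasFDerivAt f (fderiv ℂ f z) (z + (0 : ℂ) • v) := by
      simpa using (hf z).hasFDerivAt
    exact (h1.comp_hasDerivAt 0 (hline 0)).deriv
  have := Complex.norm_deriv_le_of_forall_mem_sphere_norm_le (c := 0) (R := (1 - r) / ‖v‖) (C := M)
    (div_pos hr' hv') hdiff.diffContOnCl fun t ht => by
      refine h _ ((norm_add_le _ _).trans ?_)
      rw [norm_smul, mem_sphere_zero_iff_norm.1 ht, div_mul_cancel₀ _ hv'.ne']
      linarith
  rw [hderiv] at this
  refine this.trans (le_of_eq ?_)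
  field_simp

theorem continuousOn_differentiableOn_tsum_of_norm_le {V W : Type*} [NormedAddCommGroup V]
    [NormedSpace ℂ V] [NormedAddCommGroup W] [NormedSpace ℂ W] [CompleteSpace W]
    {H : ℕ → V → W} (hH : ∀ n, Differentiable ℂ (H n)) {u : ℕ → ℝ} (hu : Summable u)
    (hHu : ∀ n z, ‖z‖ ≤ 1 → ‖H n z‖ ≤ u n) :
    ContinuousOn (fun z => ∑' n, H n z) (Metric.closedBall 0 1) ∧
      DifferentiableOn ℂ (fun z => ∑' n, H n z) (Metric.ball 0 1) := by
  constructor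
  · exact continuousOn_tsum (fun n => (hH n).continuous.continuousOn) hu
      fun n z hz => hHu n z (mem_closedBall_zero_iff.1 hz)
  · intro z hz
    rw [mem_ball_zero_iff] at hz
    obtain ⟨r, hzr, hr⟩ := exists_between hz
    have hu0 : ∀ n, 0 ≤ u n := fun n => (norm_nonneg _).trans (hHu n 0 (by simp))
    have h0 : (0 : V) ∈ Metric.ball (0 : V) r := by
      simpa using (norm_nonneg z).trans_lt hzr
    refine (hasFDerivAt_tsum_of_isPreconnected (u := fun n => u n / (1 - r)) (hu.div_const _)
      Metric.isOpen_ball (convex_ball (0 : V) r).isPreconnected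
      (fun n x _ => (hH n x).hasFDerivAt) (fun n x hx => ?_) h0 ?_
      (mem_ball_zero_iff.2 hzr)).differentiableAt.differentiableWithinAt
    · exact norm_fderiv_le_of_norm_le (hH n) hr (hu0 n) (hHu n) (mem_ball_zero_iff.1 hx).le
    · exact Summable.of_norm_bounded hu fun n => hHu n 0 (by simp)

/-- Iterating a correction step which shrinks the deficiency `φ - ‖g‖²` by a fixed factor yields
a map with `‖G‖² = φ` on the sphere. -/
theorem exists_norm_sq_eq_of_correction {V W : Type*} [NormedAddCommGroup V] [NormedSpace ℂ V]
    [FiniteDimensional ℂ V] [Nontrivial V] [NormedAddCommGroup W] [NormedSpace ℂ W]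
    [CompleteSpace W] {κ : ℝ} (hκ0 : 0 < κ) (hκ1 : κ < 1) {φ : V → ℝ}
    (hφ : ContinuousOn φ (Metric.sphere 0 1)) (hpos : ∀ z, ‖z‖ = 1 → 0 < φ z)
    (hcorr : ∀ g : V → W, Differentiable ℂ g → (∀ z, ‖z‖ = 1 → ‖g z‖ ^ 2 < φ z) →
      ∃ h : V → W, Differentiable ℂ h ∧ ∀ z, ‖z‖ = 1 →
        ‖h z‖ ^ 2 ≤ φ z - ‖g z‖ ^ 2 ∧ ‖g z + h z‖ ^ 2 < φ z ∧
        φ z - ‖g z + h z‖ ^ 2 ≤ (1 - κ) * (φ z - ‖g z‖ ^ 2)) :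
    ∃ G : V → W, ContinuousOn G (Metric.closedBall 0 1) ∧
      DifferentiableOn ℂ G (Metric.ball 0 1) ∧ ∀ z, ‖z‖ = 1 → ‖G z‖ ^ 2 = φ z := by
  have : ProperSpace V := FiniteDimensional.proper ℂ V
  obtain ⟨M, hM0, hM⟩ : ∃ M, 0 ≤ M ∧ ∀ z, ‖z‖ = 1 → φ z ≤ M := by
    obtain ⟨M, hM⟩ := (isCompact_sphere (0 : V) 1).bddAbove_image hφ
    exact ⟨max M 0, le_max_right _ _, fun z hz =>
      (hM (Set.mem_image_of_mem φ (mem_sphere_zero_iff_norm.2 hz))).trans (le_max_left _ _)⟩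
  let X := {g : V → W // Differentiable ℂ g ∧ ∀ z, ‖z‖ = 1 → ‖g z‖ ^ 2 < φ z}
  choose h hd hh using fun g : X => hcorr g.1 g.2.1 g.2.2
  let next : X → X := fun g =>
    ⟨fun z => g.1 z + h g z, g.2.1.add (hd g), fun z hz => (hh g z hz).2.1⟩
  let init : X := ⟨fun _ => 0, differentiable_const _, fun z hz => by simpa using hpos z hz⟩
  let g : ℕ → X := fun n => Nat.rec init (fun _ => next) n
  have hg_succ : ∀ n z, (g (n + 1)).1 z = (g n).1 z + h (g n) z := fun n z => rfl
  have hsum : ∀ n z, ∑ k ∈ Finset.range n, h (g k) z = (g n).1 z := by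
    intro n z
    induction n with
    | zero => rfl
    | succ n ih => rw [Finset.sum_range_succ, ih, hg_succ]
  have hdef : ∀ n z, ‖z‖ = 1 → φ z - ‖(g n).1 z‖ ^ 2 ≤ (1 - κ) ^ n * M := by
    intro n z hz
    induction n with
    | zero => simpa [g, init] using hM z hz
    | succ n ih =>
      rw [hg_succ, pow_succ' (1 - κ), mul_assoc]
      exact (hh (g n) z hz).2.2.trans (mul_le_mul_of_nonneg_left ih (by linarith))
  -- A correction is bounded by the square root of the deficiency, hence the ratio √(1 - κ).
  set r : ℝ := Real.sqrt (1 - κ) with hr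
  have hr0 : 0 ≤ r := Real.sqrt_nonneg _
  have hr1 : r < 1 := by rw [hr, Real.sqrt_lt' one_pos]; linarith
  have hr2 : r ^ 2 = 1 - κ := Real.sq_sqrt (by linarith)
  have hsphere : ∀ n z, ‖z‖ = 1 → ‖h (g n) z‖ ≤ r ^ n * Real.sqrt M := by
    intro n z hz
    refine le_of_sq_le_sq ?_ (by positivity)
    rw [mul_pow, ← pow_mul, mul_comm n 2, pow_mul, hr2, Real.sq_sqrt hM0]
    exact (hh (g n) z hz).1.trans (hdef n z hz)
  have hball : ∀ n z, ‖z‖ ≤ 1 → ‖h (g n) z‖ ≤ r ^ n * Real.sqrt M := by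
    intro n z hz
    refine Complex.norm_le_of_forall_mem_frontier_norm_le (Metric.isBounded_ball (x := (0 : V))
      (r := 1)) (hd (g n)).diffContOnCl (fun w hw => hsphere n w ?_) ?_
    · rw [frontier_ball _ one_ne_zero] at hw
      exact mem_sphere_zero_iff_norm.1 hw
    · rw [closure_ball _ one_ne_zero]
      exact mem_closedBall_zero_iff.2 hz
  have hu : Summable fun n => r ^ n * Real.sqrt M :=
    (summable_geometric_of_lt_one hr0 hr1).mul_right _
  obtain ⟨hGc, hGd⟩ := continuousOn_differentiableOn_tsum_of_norm_le (fun n => hd (g n)) hu hball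
  refine ⟨_, hGc, hGd, fun z hz => ?_⟩
  have h1 : Filter.Tendsto (fun n => (g n).1 z) Filter.atTop (nhds (∑' n, h (g n) z)) := by
    have := (Summable.of_norm_bounded hu fun n => hball n z hz.le).hasSum.tendsto_sum_nat
    simpa only [hsum] using this
  have h2 : Filter.Tendsto (fun n => φ z - ‖(g n).1 z‖ ^ 2) Filter.atTop (nhds 0) := by
    refine squeeze_zero (fun n => (sub_pos.2 ((g n).2.2 z hz)).le) (fun n => hdef n z hz) ?_
    have := (tendsto_pow_atTop_nhds_zero_of_lt_one (r := 1 - κ) (by linarith) (by linarith)).mul_const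
      M
    simpa using this
  have h3 := tendsto_nhds_unique h2 ((h1.norm.pow 2).const_sub (φ z))
  linarith

/-- Løw's theorem for the unit ball: every positive continuous function on the sphere is the
boundary value of the squared norm of a vector valued function which is holomorphic in the ball and
continuous up to the boundary. -/
theorem exists_norm_sq_eq_on_sphere {ι : Type} [Fintype ι] [Nonempty ι]
    {φ : EuclideanSpace ℂ ι → ℝ} (hφ : ContinuousOn φ (Metric.sphere 0 1))
    (hpos : ∀ z, ‖z‖ = 1 → 0 < φ z) :
    ∃ (K : ℕ) (G : EuclideanSpace ℂ ι → EuclideanSpace ℂ (Fin K)),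
      ContinuousOn G (Metric.closedBall 0 1) ∧ DifferentiableOn ℂ G (Metric.ball 0 1) ∧
      ∀ z, ‖z‖ = 1 → ‖G z‖ ^ 2 = φ z := by
  classical
  obtain ⟨C, _, κ, hκ0, hκ1, hcorr⟩ := exists_correction ι
  suffices h : ∃ G : EuclideanSpace ℂ ι → PairSpace C,
      ContinuousOn G (Metric.closedBall 0 1) ∧ DifferentiableOn ℂ G (Metric.ball 0 1) ∧
      ∀ z, ‖z‖ = 1 → ‖G z‖ ^ 2 = φ z by
    obtain ⟨G, hGc, hGd, hG⟩ := h
    let e := (stdOrthonormalBasis ℂ (PairSpace C)).repr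
    refine ⟨Module.finrank ℂ (PairSpace C), fun z => e (G z), e.continuous.comp_continuousOn hGc,
      e.toContinuousLinearEquiv.differentiable.comp_differentiableOn hGd, fun z hz => ?_⟩
    rw [e.norm_map, hG z hz]
  exact exists_norm_sq_eq_of_correction hκ0 hκ1 hφ hpos
    fun g hg hgφ => hcorr g φ hg hφ hgφ

/-! ### A function with continuous modulus that spirals at the point 1 -/

/-- The function `log (e³ / (1 - w))`; its values for `‖w‖ ≤ 1` have real
part at least `1`. -/
noncomputable def shiftedLog (w : ℂ) : ℂ := 3 - Complex.log (1 - w)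

/-- A bounded holomorphic function on the unit disc whose modulus, but not the function itself,
extends continuously to the point `1`. -/
noncomputable def spiral (w : ℂ) : ℂ := Complex.exp (Complex.I * Complex.log (shiftedLog w))

theorem one_le_re_shiftedLog {w : ℂ} (hw : ‖w‖ ≤ 1) : 1 ≤ (shiftedLog w).re := by
  have h1 : ‖1 - w‖ ≤ 2 := (norm_sub_le _ _).trans (by rw [norm_one]; linarith)
  have h2 : Real.log ‖1 - w‖ ≤ 2 := by
    rcases eq_or_ne ‖1 - w‖ 0 with h | h
    · rw [h]; simp
    · exact (Real.log_le_sub_one_of_pos (lt_of_le_of_ne (norm_nonneg _) h.symm)).trans (by linarith)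
  have h3 : (shiftedLog w).re = 3 - Real.log ‖1 - w‖ := by
    simp [shiftedLog, Complex.log_re]
  linarith

theorem one_sub_mem_slitPlane {w : ℂ} (hw : ‖w‖ ≤ 1) (hw1 : w ≠ 1) :
    1 - w ∈ Complex.slitPlane := by
  have h := Complex.re_le_norm w
  rcases lt_or_eq_of_le (h.trans hw) with h1 | h1
  · left; simpa using h1
  · exfalso
    apply hw1
    have h2 := Complex.sq_norm w
    rw [Complex.normSq_apply, h1] at h2
    have h3 : ‖w‖ ^ 2 ≤ 1 := by nlinarith [norm_nonneg w]
    have h4 : w.im = 0 := by nlinarith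
    exact Complex.ext h1 h4

theorem shiftedLog_mem_slitPlane {w : ℂ} (hw : ‖w‖ ≤ 1) : shiftedLog w ∈ Complex.slitPlane :=
  Or.inl (lt_of_lt_of_le one_pos (one_le_re_shiftedLog hw))

theorem differentiableAt_spiral {w : ℂ} (hw : ‖w‖ ≤ 1) (hw1 : w ≠ 1) :
    DifferentiableAt ℂ spiral w := by
  have h1 : DifferentiableAt ℂ shiftedLog w := by
    unfold shiftedLog
    exact ((differentiableAt_const _).sub differentiableAt_id).clog
      (one_sub_mem_slitPlane hw hw1) |>.const_sub 3
  unfold spiral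
  exact ((h1.clog (shiftedLog_mem_slitPlane hw)).const_mul _).cexp

theorem norm_spiral (w : ℂ) : ‖spiral w‖ = Real.exp (-(shiftedLog w).arg) := by
  rw [spiral, Complex.norm_exp]
  simp [Complex.log_im]

theorem norm_spiral_lt {w : ℂ} (hw : ‖w‖ ≤ 1) : ‖spiral w‖ < 5 := by
  have h := Complex.abs_arg_lt_pi_div_two_iff.2
    (Or.inl (lt_of_lt_of_le one_pos (one_le_re_shiftedLog hw)))
  rw [norm_spiral]
  have h1 : -(shiftedLog w).arg < 1.6 := by
    have := (abs_lt.1 h).1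
    have := Real.pi_lt_d2
    linarith
  refine (Real.exp_lt_exp.2 h1).trans ?_
  -- Since π / 2 < 1.6, it remains to see e^1.6 < 5, that is e⁸ < 5⁵.
  have h3 : Real.exp 1.6 ^ 5 = Real.exp 1 ^ 8 := by
    rw [← Real.exp_nat_mul, ← Real.exp_nat_mul]; norm_num
  have h4 := Real.exp_one_lt_d9
  refine lt_of_pow_lt_pow_left₀ 5 (by norm_num) ?_
  rw [h3]
  calc Real.exp 1 ^ 8 < 2.7182818286 ^ 8 := by gcongr
    _ < 5 ^ 5 := by norm_num

/-- The modulus is exp(-arg) of `shiftedLog`. At 1 the real part of `shiftedLog` tends to infinity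
while its imaginary part stays bounded by π, so the argument tends to 0. -/
theorem continuousOn_norm_spiral : ContinuousOn (fun w => ‖spiral w‖) (Metric.closedBall 0 1) := by
  intro w hw
  rw [mem_closedBall_zero_iff] at hw
  rcases eq_or_ne w 1 with rfl | hw1
  swap
  · exact (differentiableAt_spiral hw hw1).continuousAt.norm.continuousWithinAt
  simp only [norm_spiral]
  refine Real.continuous_exp.continuousAt.comp_continuousWithinAt (ContinuousWithinAt.neg ?_)
  -- The default `log 0 = 0` gives `shiftedLog 1 = 3`, whose argument 0 agrees with the limit.
  have h1 : (shiftedLog 1).arg = 0 := by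
    have h : shiftedLog 1 = ((3 : ℝ) : ℂ) := by simp [shiftedLog]
    rw [h, Complex.arg_ofReal_of_nonneg (by norm_num)]
  rw [← continuousWithinAt_sdiff_self, ContinuousWithinAt, h1]
  have hre : Filter.Tendsto (fun w => (shiftedLog w).re)
      (nhdsWithin 1 (Metric.closedBall 0 1 \ {1})) Filter.atTop := by
    have h2 : (fun w => (shiftedLog w).re) = fun w => 3 - Real.log ‖1 - w‖ := by
      ext w
      simp [shiftedLog, Complex.log_re]
    rw [h2]
    have h3 : Filter.Tendsto (fun w : ℂ => ‖1 - w‖) (nhdsWithin 1 (Metric.closedBall 0 1 \ {1}))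
        (nhdsWithin 0 {0}ᶜ) := by
      refine tendsto_nhdsWithin_iff.2 ⟨?_, ?_⟩
      · have : ContinuousAt (fun w : ℂ => ‖1 - w‖) 1 := by fun_prop
        simpa [ContinuousAt] using this.tendsto.mono_left nhdsWithin_le_nhds
      · filter_upwards [self_mem_nhdsWithin] with w hw
        simpa [sub_eq_zero] using fun h => hw.2 (Eq.symm h)
    have h4 := Filter.tendsto_neg_atBot_atTop.comp (Real.tendsto_log_nhdsNE_zero.comp h3)
    exact Filter.tendsto_atTop_add_const_left _ 3 h4
  -- Dividing by the positive real part preserves the argument and gives a quotient tending to 1,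
  -- where arg is continuous.
  have hquot : Filter.Tendsto (fun w => (((shiftedLog w).re⁻¹ : ℝ) : ℂ) * shiftedLog w)
      (nhdsWithin 1 (Metric.closedBall 0 1 \ {1})) (nhds 1) := by
    rw [tendsto_iff_norm_sub_tendsto_zero]
    have hlim := (tendsto_inv_atTop_zero.comp hre).mul_const Real.pi
    rw [zero_mul] at hlim
    refine squeeze_zero' (Filter.Eventually.of_forall fun _ => norm_nonneg _) ?_ hlim
    filter_upwards [self_mem_nhdsWithin] with w hw
    have hpos : 0 < (shiftedLog w).re :=
      lt_of_lt_of_le one_pos (one_le_re_shiftedLog (mem_closedBall_zero_iff.1 hw.1))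
    have h5 : (((shiftedLog w).re⁻¹ : ℝ) : ℂ) * shiftedLog w - 1 =
        (((shiftedLog w).re⁻¹ * (shiftedLog w).im : ℝ) : ℂ) * Complex.I := by
      apply Complex.ext
      · simp [hpos.ne']
      · simp
    rw [h5, norm_mul, Complex.norm_I, mul_one, Complex.norm_real, norm_mul,
      Real.norm_of_nonneg (inv_pos.2 hpos).le]
    refine mul_le_mul_of_nonneg_left ?_ (inv_pos.2 hpos).le
    have : (shiftedLog w).im = -(1 - w).arg := by simp [shiftedLog, Complex.log_im]
    rw [this, Real.norm_eq_abs, abs_neg]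
    exact Complex.abs_arg_le_pi _
  have harg := (Complex.continuousAt_arg Complex.one_mem_slitPlane).tendsto.comp hquot
  rw [Complex.arg_one] at harg
  refine harg.congr' ?_
  filter_upwards [self_mem_nhdsWithin] with w hw
  exact Complex.arg_real_mul _
    (inv_pos.2 (lt_of_lt_of_le one_pos (one_le_re_shiftedLog (mem_closedBall_zero_iff.1 hw.1))))

/-- On the real axis `shiftedLog` increases to infinity at 1, so `spiral` winds round the unit
circle infinitely often; x n solves `shiftedLog` = exp(θ + 2πn). -/
theorem exists_seq_spiral_eq (θ : ℝ) :
    ∃ x : ℕ → ℝ, Filter.Tendsto x Filter.atTop (nhds 1) ∧ (∀ᶠ n in Filter.atTop, |x n| < 1) ∧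
      ∀ n, spiral (x n) = Complex.exp (θ * Complex.I) := by
  have hlim : Filter.Tendsto (fun n : ℕ => Real.exp (3 - Real.exp (θ + n * (2 * Real.pi))))
      Filter.atTop (nhds 0) := by
    refine Real.tendsto_exp_atBot.comp ?_
    refine Filter.tendsto_atBot_add_const_left _ 3 (Filter.tendsto_neg_atTop_atBot.comp ?_)
    refine Real.tendsto_exp_atTop.comp (Filter.tendsto_atTop_add_const_left _ θ ?_)
    exact tendsto_natCast_atTop_atTop.atTop_mul_const Real.two_pi_pos
  refine ⟨fun n => 1 - Real.exp (3 - Real.exp (θ + n * (2 * Real.pi))), ?_, ?_, fun n => ?_⟩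
  · simpa using hlim.const_sub 1
  · filter_upwards [hlim.eventually_lt_const (show (0 : ℝ) < 1 by norm_num)] with n hn
    have := Real.exp_pos (3 - Real.exp (θ + n * (2 * Real.pi)))
    rw [abs_lt]
    constructor <;> linarith
  · have h1 : shiftedLog ((1 - Real.exp (3 - Real.exp (θ + n * (2 * Real.pi))) : ℝ) : ℂ) =
        ((Real.exp (θ + n * (2 * Real.pi)) : ℝ) : ℂ) := by
      rw [shiftedLog, Complex.ofReal_sub, Complex.ofReal_one, sub_sub_cancel,
        ← Complex.ofReal_log (Real.exp_pos _).le, Real.log_exp]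
      push_cast
      ring
    rw [spiral, h1, ← Complex.ofReal_log (Real.exp_pos _).le, Real.log_exp]
    have h2 : Complex.I * ((θ + n * (2 * Real.pi) : ℝ) : ℂ) =
        θ * Complex.I + n * (2 * Real.pi * Complex.I) := by
      push_cast
      ring
    rw [h2]
    exact Complex.exp_periodic.nat_mul n _

/-! ### The proper map on the unit ball -/

theorem exists_ball_map {ι : Type} [Fintype ι] (i₀ : ι) :
    ∃ (K : ℕ) (G : EuclideanSpace ℂ ι → EuclideanSpace ℂ (Fin K)), 1 ≤ K ∧
      DifferentiableOn ℂ G (Metric.ball 0 1) ∧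
      (∀ z, ‖z‖ < 1 → ‖spiral (z i₀) / 10‖ ^ 4 + ‖G z‖ ^ 2 < 1) ∧
      ∀ c : ℝ, c < 1 → ∃ r : ℝ, r < 1 ∧ ∀ z, ‖z‖ < 1 →
        ‖spiral (z i₀) / 10‖ ^ 4 + ‖G z‖ ^ 2 ≤ c → ‖z‖ ≤ r := by
  classical
  have : Nonempty ι := ⟨i₀⟩
  set a : EuclideanSpace ℂ ι → ℂ := fun z => spiral (z i₀) / 10 with ha
  have hcoord : ∀ z : EuclideanSpace ℂ ι, ‖z i₀‖ ≤ ‖z‖ := fun z => PiLp.norm_apply_le z i₀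
  have hanorm : ContinuousOn (fun z => ‖a z‖) (Metric.closedBall 0 1) := by
    have h1 : ContinuousOn (fun z : EuclideanSpace ℂ ι => ‖spiral (z i₀)‖)
        (Metric.closedBall 0 1) :=
      continuousOn_norm_spiral.comp (f := fun z : EuclideanSpace ℂ ι => z i₀) (by fun_prop)
        fun z hz => mem_closedBall_zero_iff.2
          ((hcoord z).trans (mem_closedBall_zero_iff.1 hz))
    simpa only [ha, norm_div] using h1.div_const _
  have had : DifferentiableOn ℂ a (Metric.ball 0 1) := by
    intro z hz
    have hz1 : ‖z i₀‖ < 1 := (hcoord z).trans_lt (mem_ball_zero_iff.1 hz)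
    have h1 : DifferentiableAt ℂ (fun z : EuclideanSpace ℂ ι => z i₀) z := by fun_prop
    have h2 := (differentiableAt_spiral hz1.le (fun h => by rw [h] at hz1; simp at hz1)).comp z h1
    simpa only [ha, div_eq_mul_inv, Function.comp_def] using
      (h2.mul_const (10 : ℂ)⁻¹).differentiableWithinAt
  have halt : ∀ z, ‖z‖ ≤ 1 → ‖a z‖ < 1 := fun z hz => by
    have := norm_spiral_lt ((hcoord z).trans hz)
    rw [ha, norm_div]
    norm_num
    linarith
  obtain ⟨K, G, hGc, hGd, hG⟩ := exists_norm_sq_eq_on_sphere (φ := fun z => 1 - ‖a z‖ ^ 4)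
    (continuousOn_const.sub ((hanorm.mono Metric.sphere_subset_closedBall).pow 4))
    fun z hz => by
      have := pow_lt_one₀ (norm_nonneg _) (halt z hz.le) (n := 4) (by norm_num)
      linarith
  have hS : ∀ z, ‖z‖ = 1 → ‖a z‖ ^ 4 + ‖G z‖ ^ 2 = 1 := fun z hz => by rw [hG z hz]; ring
  have hcont : ContinuousOn (fun z => ‖a z‖ ^ 4 + ‖G z‖ ^ 2) (Metric.closedBall 0 1) :=
    (hanorm.pow 4).add (hGc.norm.pow 2)
  have hcomp := isCompact_closedBall (0 : EuclideanSpace ℂ ι) 1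
  refine ⟨K, G, ?_, hGd, ?_, fun c hc => ?_⟩
  · rw [Nat.one_le_iff_ne_zero]
    rintro rfl
    have h1 : ‖EuclideanSpace.single i₀ (1 : ℂ)‖ = 1 := by simp
    have h2 := hG _ h1
    rw [Subsingleton.elim (G _) 0, norm_zero] at h2
    have := pow_lt_one₀ (norm_nonneg _) (halt _ h1.le) (n := 4) (by norm_num)
    linarith
  · by_contra! hne
    obtain ⟨z₀, hz₀, hz₀1⟩ := hne
    -- If the maximum over the closed ball lies on the sphere it equals 1, and then z₀ is already an
    -- interior maximum point.
    obtain ⟨v, hv, hvmax⟩ : ∃ v, ‖v‖ < 1 ∧ ∀ z, ‖z‖ < 1 →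
        ‖a z‖ ^ 4 + ‖G z‖ ^ 2 ≤ ‖a v‖ ^ 4 + ‖G v‖ ^ 2 := by
      obtain ⟨z₁, hz₁, hmax⟩ := hcomp.exists_isMaxOn ⟨0, by simp⟩ hcont
      have hmax' : ∀ z, ‖z‖ < 1 → ‖a z‖ ^ 4 + ‖G z‖ ^ 2 ≤ ‖a z₁‖ ^ 4 + ‖G z₁‖ ^ 2 :=
        fun z hz => hmax (mem_closedBall_zero_iff.2 hz.le)
      rcases lt_or_eq_of_le (mem_closedBall_zero_iff.1 hz₁) with h | h
      · exact ⟨z₁, h, hmax'⟩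
      · refine ⟨z₀, hz₀, fun z hz => (hmax' z hz).trans ?_⟩
        rw [hS z₁ h]
        exact hz₀1
    set H : EuclideanSpace ℂ ι → WithLp 2 (ℂ × EuclideanSpace ℂ (Fin K)) :=
      fun z => WithLp.toLp 2 (a z ^ 2, G z) with hH
    have hHd : DifferentiableOn ℂ H (Metric.ball 0 1) :=
      (WithLp.prodContinuousLinearEquiv 2 ℂ ℂ
        (EuclideanSpace ℂ (Fin K))).symm.differentiable.comp_differentiableOn
        ((had.pow 2).prodMk hGd)
    have hHn : ∀ z, ‖H z‖ ^ 2 = ‖a z‖ ^ 4 + ‖G z‖ ^ 2 := fun z => by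
      rw [WithLp.prod_norm_sq_eq_of_L2]
      change ‖a z ^ 2‖ ^ 2 + ‖G z‖ ^ 2 = _
      rw [norm_pow]
      ring
    have hconst := Complex.eq_const_of_exists_max hHd (mem_ball_zero_iff.2 hv) fun z hz => by
      have h1 := hvmax z (mem_ball_zero_iff.1 hz)
      rw [← hHn, ← hHn] at h1
      exact le_of_sq_le_sq h1 (norm_nonneg _)
    have hsq : ∀ x : ℝ, |x| < 1 → (spiral x / 10) ^ 2 = a v ^ 2 := by
      intro x hx
      have h1 := hconst (show EuclideanSpace.single i₀ (x : ℂ) ∈ Metric.ball 0 1 by simpa using hx)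
      have h2 := congrArg (fun y : WithLp 2 (ℂ × EuclideanSpace ℂ (Fin K)) => y.fst) h1
      simpa [hH, ha] using h2
    obtain ⟨x, -, hx1, hx⟩ := exists_seq_spiral_eq 0
    -- Only a² is known to be constant, so the values compared are 1 and i, whose squares differ,
    -- rather than 1 and -1.
    obtain ⟨y, -, hy1, hy⟩ := exists_seq_spiral_eq (Real.pi / 2)
    obtain ⟨n, hxn, hyn⟩ := (hx1.and hy1).exists
    have h1 := (hsq _ hxn).trans (hsq _ hyn).symm
    rw [hx, hy] at h1
    push_cast at h1
    rw [Complex.exp_pi_div_two_mul_I, div_pow, div_pow, Complex.I_sq] at h1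
    norm_num at h1
  · set Q : Set (EuclideanSpace ℂ ι) :=
      Metric.closedBall 0 1 ∩ (fun z => ‖a z‖ ^ 4 + ‖G z‖ ^ 2) ⁻¹' Set.Iic c with hQ
    have hQc : IsCompact Q := hcomp.of_isClosed_subset
      (hcont.preimage_isClosed_of_isClosed Metric.isClosed_closedBall isClosed_Iic)
      Set.inter_subset_left
    rcases Q.eq_empty_or_nonempty with he | hne
    · refine ⟨0, one_pos, fun z hz hzc => absurd (show z ∈ Q from
        ⟨mem_closedBall_zero_iff.2 hz.le, hzc⟩) (by rw [he]; simp)⟩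
    · obtain ⟨w, hw, hmax⟩ := hQc.exists_isMaxOn hne continuous_norm.continuousOn
      refine ⟨‖w‖, lt_of_le_of_ne (mem_closedBall_zero_iff.1 hw.1) fun h => ?_, fun z hz hzc =>
        hmax (show z ∈ Q from ⟨mem_closedBall_zero_iff.2 hz.le, hzc⟩)⟩
      have := hw.2
      rw [Set.mem_preimage, hS w h, Set.mem_Iic] at this
      linarith

/-! ### Passage between pseudoellipsoids and balls -/

/-- The exponents `α_1, …, α_s, 1`. -/
def fullExponent {s : ℕ} (α : Fin s → ℕ) : Fin (s + 1) → ℕ := Fin.snoc (α := fun _ => ℕ) α 1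

/-- The polynomial map whose components are all the monomials `∏ i, z_(k), σ i` of degree `α_k` in
the `k`-th block; it pulls the unit ball back to the pseudoellipsoid. -/
noncomputable def tensorPowers {s : ℕ} (m : Fin (s + 1) → ℕ) (α : Fin s → ℕ) (Z : BlockSpace m) :
    EuclideanSpace ℂ (Σ k : Fin (s + 1), Fin (fullExponent α k) → Fin (m k)) :=
  WithLp.toLp 2 fun x => ∏ i, Z x.1 (x.2 i)

/-- Expand (∑ |z_i|²)^α over all words of length α; repeated monomials account for the multinomial
coefficients. -/
theorem norm_sq_tensorPowers {s : ℕ} (m : Fin (s + 1) → ℕ) (α : Fin s → ℕ) (Z : BlockSpace m) :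
    ‖tensorPowers m α Z‖ ^ 2 = pseudoNorm m α Z := by
  classical
  have h : ∀ k, ∑ σ : Fin (fullExponent α k) → Fin (m k), ‖∏ i, Z k (σ i)‖ ^ 2 =
      ‖Z k‖ ^ (2 * fullExponent α k) := by
    intro k
    rw [pow_mul, EuclideanSpace.norm_sq_eq, ← Fin.prod_const, Finset.prod_univ_sum]
    simp [Fintype.piFinset_univ, norm_prod, Finset.prod_pow]
  rw [EuclideanSpace.norm_sq_eq, Fintype.sum_sigma, Fin.sum_univ_castSucc, pseudoNorm]
  simp only [tensorPowers, h]
  simp [fullExponent]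

theorem differentiable_tensorPowers {s : ℕ} (m : Fin (s + 1) → ℕ) (α : Fin s → ℕ) :
    Differentiable ℂ (tensorPowers m α) := by
  rw [differentiable_euclidean]
  intro x
  have h : ∀ i, Differentiable ℂ fun Z : BlockSpace m => Z x.1 (x.2 i) := fun i => by
    have h1 := (PiLp.proj (𝕜 := ℂ) 2 (fun k : Fin (s + 1) => EuclideanSpace ℂ (Fin (m k)))
      x.1).differentiable
    have h2 := (PiLp.proj (𝕜 := ℂ) 2 (fun _ : Fin (m x.1) => ℂ) (x.2 i)).differentiable
    exact h2.comp h1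
  exact fun Z => (HasFDerivAt.finsetProd (u := Finset.univ)
    fun i _ => (h i Z).hasFDerivAt).differentiableAt

theorem continuous_pseudoNorm {s : ℕ} (m : Fin (s + 1) → ℕ) (α : Fin s → ℕ) :
    Continuous (pseudoNorm m α) := by
  unfold pseudoNorm
  fun_prop

theorem isCompact_pseudoNorm_le {s : ℕ} (m : Fin (s + 1) → ℕ) {α : Fin s → ℕ}
    (hα : ∀ k, 1 ≤ α k) {c : ℝ} (hc : c ≤ 1) : IsCompact {Z | pseudoNorm m α Z ≤ c} := by
  refine Metric.isCompact_of_isClosed_isBounded (isClosed_le (continuous_pseudoNorm m α)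
    continuous_const)
    ((Metric.isBounded_closedBall (x := (0 : BlockSpace m)) (r := Real.sqrt (s + 1))).subset
      fun Z hZ => mem_closedBall_zero_iff.2 (Real.le_sqrt_of_sq_le ?_))
  have hZ1 : pseudoNorm m α Z ≤ 1 := le_trans hZ hc
  have hk : ∀ k, ‖Z k‖ ^ 2 ≤ 1 := by
    intro k
    have hnn : ∀ k ∈ Finset.univ, 0 ≤ ‖Z (Fin.castSucc k)‖ ^ (2 * α k) := fun k _ => by positivity
    have hlast : 0 ≤ ‖Z (Fin.last s)‖ ^ 2 := by positivity
    have hsum := Finset.sum_nonneg hnn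
    unfold pseudoNorm at hZ1
    refine Fin.lastCases ?_ (fun k => ?_) k
    · linarith
    · have h1 := Finset.single_le_sum hnn (Finset.mem_univ k)
      have h2 : ‖Z k.castSucc‖ ^ (2 * α k) ≤ 1 := by linarith
      have h3 := hα k
      have h4 : ‖Z k.castSucc‖ ≤ 1 := (pow_le_one_iff_of_nonneg (norm_nonneg _) (by omega)).1 h2
      exact pow_le_one₀ (norm_nonneg _) h4
  rw [PiLp.norm_sq_eq_of_L2]
  calc ∑ k, ‖Z k‖ ^ 2 ≤ ∑ _k : Fin (s + 1), (1 : ℝ) := Finset.sum_le_sum fun k _ => hk k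
    _ = s + 1 := by simp

/-- The point `(0, …, 0, (w, 0, …, 0))`. -/
noncomputable def lastPoint {s : ℕ} {m : Fin (s + 1) → ℕ} (j : Fin (m (Fin.last s))) (w : ℂ) :
    BlockSpace m := PiLp.single 2 (Fin.last s) (EuclideanSpace.single j w)

theorem continuous_lastPoint {s : ℕ} {m : Fin (s + 1) → ℕ} (j : Fin (m (Fin.last s))) :
    Continuous (lastPoint (m := m) j) := by
  refine continuous_iff_continuousAt.2 fun w => ?_
  rw [ContinuousAt, tendsto_iff_norm_sub_tendsto_zero]
  have : ∀ v, ‖lastPoint (m := m) j v - lastPoint j w‖ = ‖v - w‖ := by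
    intro v
    rw [lastPoint, lastPoint, ← PiLp.single_sub, PiLp.norm_single, ← PiLp.single_sub,
      PiLp.norm_single]
  simp only [this]
  exact tendsto_iff_norm_sub_tendsto_zero.1 Filter.tendsto_id

theorem pseudoNorm_lastPoint {s : ℕ} {m : Fin (s + 1) → ℕ} {α : Fin s → ℕ} (hα : ∀ k, 1 ≤ α k)
    (j : Fin (m (Fin.last s))) (w : ℂ) : pseudoNorm m α (lastPoint j w) = ‖w‖ ^ 2 := by
  have h1 : ∀ k : Fin s, (lastPoint (m := m) j w) k.castSucc = 0 := fun k => by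
    simp [lastPoint, (Fin.castSucc_lt_last k).ne]
  have h2 : (lastPoint (m := m) j w) (Fin.last s) = EuclideanSpace.single j w := by
    simp [lastPoint]
  have h3 : ∀ k, 2 * α k ≠ 0 := fun k => by have := hα k; omega
  rw [pseudoNorm, h2]
  simp [h1, h3]

theorem tensorPowers_lastPoint {s : ℕ} {m : Fin (s + 1) → ℕ} (α : Fin s → ℕ)
    (j : Fin (m (Fin.last s))) (w : ℂ) :
    tensorPowers m α (lastPoint j w) ⟨Fin.last s, fun _ => j⟩ = w := by
  have h : (lastPoint (m := m) j w) (Fin.last s) = EuclideanSpace.single j w := by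
    simp [lastPoint]
  have h1 : fullExponent α (Fin.last s) = 1 := by simp [fullExponent]
  change ∏ _i : Fin (fullExponent α (Fin.last s)), (lastPoint (m := m) j w) (Fin.last s) j = w
  rw [Finset.prod_const, Finset.card_univ, Fintype.card_fin, h1, pow_one, h]
  simp

/-- The point of `ℂ^P × ℂ^K` with given blocks. -/
noncomputable def twoBlocks {P K : ℕ} (x : EuclideanSpace ℂ (Fin P)) (y : EuclideanSpace ℂ (Fin K)) :
    BlockSpace (s := 1) ![P, K] :=
  WithLp.toLp 2 fun k => match k with
    | 0 => x
    | 1 => y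

theorem pseudoNorm_twoBlocks {P K : ℕ} (x : EuclideanSpace ℂ (Fin P))
    (y : EuclideanSpace ℂ (Fin K)) :
    pseudoNorm ![P, K] (fun _ => 2) (twoBlocks x y) = ‖x‖ ^ 4 + ‖y‖ ^ 2 := by
  simp [pseudoNorm]
  rfl

theorem DifferentiableOn.twoBlocks {V : Type*} [NormedAddCommGroup V] [NormedSpace ℂ V] {P K : ℕ}
    {x : V → EuclideanSpace ℂ (Fin P)} {y : V → EuclideanSpace ℂ (Fin K)} {D : Set V}
    (hx : DifferentiableOn ℂ x D) (hy : DifferentiableOn ℂ y D) :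
    DifferentiableOn ℂ (fun z => twoBlocks (x z) (y z)) D := by
  rw [differentiableOn_piLp]
  intro k
  fin_cases k
  · exact hx
  · exact hy

theorem mem_pseudoellipsoid_iff_norm_tensorPowers {s : ℕ} {m : Fin (s + 1) → ℕ} {α : Fin s → ℕ}
    {Z : BlockSpace m} : Z ∈ pseudoellipsoid m α ↔ ‖tensorPowers m α Z‖ < 1 := by
  rw [← sq_lt_one_iff₀ (norm_nonneg _), norm_sq_tensorPowers]
  rfl

/-! ### Properness, non-extension and conclusion -/

/-- A continuous map between sublevel sets `{u < 1}` and `{v < 1}` is proper as soon as `v ∘ F`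
tends to `1` when `u` does, provided that the sets `{u ≤ r}`, `r < 1`, are compact. -/
theorem isProperMap_restrict_sublevel {V W : Type*} [TopologicalSpace V] [TopologicalSpace W]
    [T2Space W] [LocallyCompactSpace W] {u : V → ℝ} {v : W → ℝ} (hv : Continuous v)
    (hu : ∀ r < 1, IsCompact {Z | u Z ≤ r}) {F : V → W} (hF : ContinuousOn F {Z | u Z < 1})
    (hmaps : Set.MapsTo F {Z | u Z < 1} {Y | v Y < 1})
    (hproper : ∀ c : ℝ, c < 1 → ∃ r : ℝ, r < 1 ∧ ∀ Z, u Z < 1 → v (F Z) ≤ c → u Z ≤ r) :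
    IsProperMap hmaps.restrict := by
  have hopen : IsOpen {Y | v Y < 1} := isOpen_lt hv continuous_const
  have : LocallyCompactSpace {Y | v Y < 1} := hopen.locallyCompactSpace
  have hcont : Continuous hmaps.restrict := hF.mapsToRestrict hmaps
  rw [isProperMap_iff_isCompact_preimage]
  refine ⟨hcont, fun Q hQ => ?_⟩
  obtain ⟨c, hc, hcQ⟩ : ∃ c < 1, ∀ w ∈ Q, v w.1 ≤ c := by
    rcases Q.eq_empty_or_nonempty with rfl | hne
    · exact ⟨0, one_pos, by simp⟩
    · obtain ⟨w, hw, hmax⟩ := hQ.exists_isMaxOn hne (hv.comp continuous_subtype_val).continuousOn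
      exact ⟨v w.1, w.2, fun x hx => hmax hx⟩
  obtain ⟨r, hr, hrc⟩ := hproper c hc
  have hcomp : IsCompact ((↑) ⁻¹' {Z | u Z ≤ r} : Set {Z | u Z < 1}) := by
    refine Topology.IsInducing.subtypeVal.isCompact_preimage' (hu r hr) ?_
    rw [Subtype.range_coe]
    exact fun Z hZ => lt_of_le_of_lt hZ hr
  exact hcomp.of_isClosed_subset (hQ.isClosed.preimage hcont)
    fun Z hZ => hrc Z.1 Z.2 (hcQ _ hZ)

/-- All real sequences tending to 1 give boundary approaches to the single point `lastPoint j 1`, so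
an extension would fix one limit value b for u. -/
theorem eq_of_extendsContinuouslyToClosure {s : ℕ} {m : Fin (s + 1) → ℕ} {α : Fin s → ℕ}
    (hα : ∀ k, 1 ≤ α k) (j : Fin (m (Fin.last s))) {u : ℂ → ℂ}
    {W : Type*} [TopologicalSpace W] {F : BlockSpace m → W}
    (hF : ExtendsContinuouslyToClosure (pseudoellipsoid m α) F) {ℓ : W → ℂ} (hℓ : Continuous ℓ)
    (hu : ∀ w : ℂ, ‖w‖ < 1 → ℓ (F (lastPoint j w)) = u w) :
    ∃ b : ℂ, ∀ (a : ℂ) (x : ℕ → ℝ), Filter.Tendsto x Filter.atTop (nhds 1) →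
      (∀ᶠ n in Filter.atTop, |x n| < 1) → (∀ n, u (x n) = a) → a = b := by
  obtain ⟨G, hGc, hGF⟩ := hF
  have hmem : ∀ w : ℂ, ‖w‖ < 1 → lastPoint (m := m) j w ∈ pseudoellipsoid m α := fun w hw => by
    change pseudoNorm m α _ < 1
    rw [pseudoNorm_lastPoint hα]
    exact pow_lt_one₀ (norm_nonneg _) hw two_ne_zero
  refine ⟨ℓ (G (lastPoint j 1)), fun a x hx hx1 hax => ?_⟩
  have hlim : Filter.Tendsto (fun n => lastPoint (m := m) j (x n : ℂ)) Filter.atTop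
      (nhds (lastPoint j 1)) := by
    have h1 : Filter.Tendsto (fun n => (x n : ℂ)) Filter.atTop (nhds 1) := by
      simpa [Function.comp_def] using (Complex.continuous_ofReal.tendsto 1).comp hx
    exact ((continuous_lastPoint j).tendsto 1).comp h1
  have hev : ∀ᶠ n in Filter.atTop, lastPoint (m := m) j (x n : ℂ) ∈ pseudoellipsoid m α :=
    hx1.mono fun n hn => hmem _ (by simpa using hn)
  have hcl : lastPoint (m := m) j 1 ∈ closure (pseudoellipsoid m α) :=
    mem_closure_of_tendsto hlim hev
  have hG : Filter.Tendsto (fun n => ℓ (G (lastPoint (m := m) j (x n : ℂ)))) Filter.atTop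
      (nhds (ℓ (G (lastPoint j 1)))) :=
    (hℓ.tendsto _).comp ((hGc _ hcl).tendsto.comp
      (tendsto_nhdsWithin_iff.2 ⟨hlim, hev.mono fun n hn => subset_closure hn⟩))
  refine tendsto_nhds_unique (tendsto_const_nhds.congr' ?_) hG
  filter_upwards [hx1] with n hn
  have hn' : ‖(x n : ℂ)‖ < 1 := by simpa using hn
  rw [hGF (hmem _ hn'), hu _ hn', hax]

theorem mainTheorem1 (s : ℕ) (m : Fin (s + 1) → ℕ) (hm : ∀ k, 1 ≤ m k)
    (α : Fin s → ℕ) (hα : ∀ k, 1 ≤ α k) :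
    ∃ (t : ℕ) (n : Fin (t + 1) → ℕ) (β : Fin t → ℕ),
      1 ≤ t ∧ (∀ k, 1 ≤ n k) ∧ (∀ k, 2 ≤ β k) ∧
      ∑ k, m k < ∑ k, n k ∧
      ∃ F : BlockSpace m → BlockSpace n,
        IsProperHolomorphic (pseudoellipsoid m α) (pseudoellipsoid n β) F ∧
        ¬ ExtendsContinuouslyToClosure (pseudoellipsoid m α) F := by
  classical
  let j : Fin (m (Fin.last s)) := ⟨0, hm _⟩
  let i₀ : Σ k : Fin (s + 1), Fin (fullExponent α k) → Fin (m k) := ⟨Fin.last s, fun _ => j⟩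
  obtain ⟨K, G, hK, hGd, hlt, hproper⟩ := exists_ball_map i₀
  set a : BlockSpace m → ℂ := fun Z => spiral (tensorPowers m α Z i₀) / 10 with ha
  -- Only one coordinate of the first block is used; padding it with zeros to length ∑ m + 1 forces
  -- the increase of dimension.
  let F : BlockSpace m → BlockSpace (s := 1) ![∑ k, m k + 1, K] := fun Z =>
    twoBlocks (EuclideanSpace.single 0 (a Z)) (G (tensorPowers m α Z))
  have hFn : ∀ Z, pseudoNorm _ (fun _ => 2) (F Z) =
      ‖a Z‖ ^ 4 + ‖G (tensorPowers m α Z)‖ ^ 2 := fun Z => by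
    simp only [F]
    rw [pseudoNorm_twoBlocks, PiLp.norm_single]
  have hball : Set.MapsTo (tensorPowers m α) (pseudoellipsoid m α) (Metric.ball 0 1) :=
    fun Z hZ => mem_ball_zero_iff.2 (mem_pseudoellipsoid_iff_norm_tensorPowers.1 hZ)
  have had : DifferentiableOn ℂ a (pseudoellipsoid m α) := by
    intro Z hZ
    have h1 : ‖tensorPowers m α Z i₀‖ < 1 :=
      (PiLp.norm_apply_le _ i₀).trans_lt (mem_pseudoellipsoid_iff_norm_tensorPowers.1 hZ)
    have h2 : DifferentiableAt ℂ (fun Z => tensorPowers m α Z i₀) Z :=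
      differentiable_euclidean.1 (differentiable_tensorPowers m α) i₀ Z
    have h3 := (differentiableAt_spiral h1.le (fun h => by rw [h] at h1; simp at h1)).comp Z h2
    simpa only [ha, div_eq_mul_inv, Function.comp_def] using
      (h3.mul_const (10 : ℂ)⁻¹).differentiableWithinAt
  refine ⟨1, ![∑ k, m k + 1, K], fun _ => 2, le_rfl, ?_, fun _ => le_rfl, ?_, F, ?_, fun hext => ?_⟩
  · rw [Fin.forall_fin_two]
    exact ⟨Nat.le_add_left _ _, hK⟩
  · rw [Fin.sum_univ_two]
    simp
    omega
  · have hFd : DifferentiableOn ℂ F (pseudoellipsoid m α) := by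
      refine DifferentiableOn.twoBlocks ?_
        (hGd.comp (differentiable_tensorPowers m α).differentiableOn hball)
      rw [differentiableOn_euclidean]
      intro i
      by_cases hi : i = 0
      · subst hi
        simpa using had
      · simp [hi]
    have hmaps : Set.MapsTo F (pseudoellipsoid m α) (pseudoellipsoid _ fun _ => 2) := by
      intro Z hZ
      change pseudoNorm _ _ (F Z) < 1
      rw [hFn]
      exact hlt _ (mem_pseudoellipsoid_iff_norm_tensorPowers.1 hZ)
    refine ⟨hFd, hmaps, isProperMap_restrict_sublevel (continuous_pseudoNorm _ _)
      (fun r hr => isCompact_pseudoNorm_le m hα hr.le) hFd.continuousOn hmaps fun c hc => ?_⟩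
    obtain ⟨r, hr, h⟩ := hproper c hc
    -- The radius r may be negative, hence the maximum with 0 before squaring.
    refine ⟨max r 0 ^ 2, pow_lt_one₀ (le_max_right _ _) (max_lt hr one_pos) two_ne_zero,
      fun Z hZ hZc => ?_⟩
    rw [hFn] at hZc
    rw [← norm_sq_tensorPowers]
    have := h _ (mem_pseudoellipsoid_iff_norm_tensorPowers.1 hZ) hZc
    exact pow_le_pow_left₀ (norm_nonneg _) (this.trans (le_max_left _ _)) 2
  · obtain ⟨b, hb⟩ := eq_of_extendsContinuouslyToClosure hα j (u := fun w => spiral w / 10) hext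
      (ℓ := fun Y => Y 0 (0 : Fin (∑ k, m k + 1))) (by fun_prop) fun w _ => by
        have : tensorPowers m α (lastPoint j w) i₀ = w := tensorPowers_lastPoint α j w
        change (EuclideanSpace.single (0 : Fin (∑ k, m k + 1)) (a (lastPoint j w))) 0 = _
        simp [ha, this]
    obtain ⟨x, hx, hx1, hxs⟩ := exists_seq_spiral_eq 0
    obtain ⟨y, hy, hy1, hys⟩ := exists_seq_spiral_eq (Real.pi / 2)
    have h1 := hb _ x hx hx1 fun n => congrArg (· / 10) (hxs n)
    have h2 := hb _ y hy hy1 fun n => congrArg (· / 10) (hys n)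
    have h3 := h1.trans h2.symm
    push_cast at h3
    rw [Complex.exp_pi_div_two_mul_I] at h3
    have := congrArg Complex.im h3
    norm_num at this
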